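/- **Model.** Let $L,J$ be numbers of service classes and of received power classes, $0<\rho\le 1$, $N_0,W>0$, $P_1,\dots,P_J>0$, and, for $1\le l\le L$, $0<P_{e,l}<1$ and a positive integer $M_l$. A message of class $(l,j)$ has service requirement $S_l=-\ln P_{e,l}+\rho\ln M_l$ and received power $P_j$. Time is slotted. The numbers $A_{lj}$ of class-$(l,j)$ messages that arrive in a slot are independent over classes and slots, with law $p_{lj}$ not depending on the slot, and $\mathbb E A_{lj}^2<\infty$. A schedule $s=(s_{lj})\in\mathbb Z_+^{LJ}$ gives the number of messages of each class transmitted in a slot. Under $s$, each transmitted message of received power class $j$ receives in that slot the service quantum $$\phi_j(s)=\rho\ln\Bigl(1+\frac{P_j}{(1+\rho)\bigl(N_0W+\sum_{l',j'}s_{l'j'}P_{j'}-P_j\bigr)}\Bigr)\quad\text{if }\sum_l s_{lj}>0,$$ and $\phi_j(s)=0$ if $\sum_l s_{lj}=0$. For an integer $K\ge1$, $\underline\phi_j$ is the minimum of $\phi_j(s)$ over the schedules $s$ with $\sum_{l,j'}s_{lj'}=K$ and $\sum_l s_{lj}>0$. A state $\alpha=((x_1,l_1,j_1),\dots,(x_n,l_n,j_n))$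 lists the residual service requirement and the class of each of the $n=n(\alpha)$ messages in the system; the residual requirements are the positive values obtained from the $S_l$ by successively subtracting quanta $\phi_j(s)$ of schedules with $\sum_{l,j}s_{lj}\le K$, so the set of states is countable. A non-idling policy $\omega$ draws in each slot, with a law that depends only on the state $\alpha$, a schedule $s$ with $s_{lj}\le n_{lj}(\alpha)$ for all $l,j$ and $\sum_{l,j}s_{lj}=\min(K,n(\alpha))$, where $n_{lj}(\alpha)$ is the number of class-$(l,j)$ messages in $\alpha$ (deterministic policies are included); which $s_{lj}$ messages of class $(l,j)$ are transmitted is decided by an arbitrary, possibly random, rule that depends only on $\alpha$ and $s$. The residual requirement of a transmitted message of power class $j$ decreases by $\phi_j(s)$; the message leaves when its residual requirement is at most $\phi_j(s)$. Then the new messages of the slot join at the end of the state vector, ordered by class. This defines a Markov chain $(X_n)_{n\ge0}$ on the set of states. With $\tau_\beta=\min\{n\ge1:X_n=\beta\}$, call the chain *positive recurrent* if there is a state $\beta$ such that $\mathbb E_\alpha\tau_\beta<\infty$ for every state $\alpha$ (for an irreducible chain this is the usual notion), and *transient* if every state is transient, i.e. $\mathbb P_\alpha(\tau_\alpha<\infty)<1$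 for every state $\alpha$. **Theorem.** Let $K=1$. For every non-idling policy $\omega$ (and every rule that selects messages within the classes): (a) if $\sum_{l=1}^{L}\sum_{j=1}^{J}\mathbb E A_{lj}\,\lceil S_l/\underline\phi_j\rceil<1$, then the chain is positive recurrent, it has exactly one stationary distribution $\pi$, and the stationary mean number $\sum_\alpha\pi(\alpha)\,n_{lj}(\alpha)$ of messages of each class $(l,j)$ is finite; (b) if $\sum_{l=1}^{L}\sum_{j=1}^{J}\mathbb E A_{lj}\,\lceil S_l/\underline\phi_j\rceil>1$, then the chain is transient. -/

import Mathlib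

open scoped ENNReal

noncomputable section

/-! Discrete-time Markov chains given by a transition law `P : X → PMF X`. -/

namespace DiscreteChain

variable {X : Type*}

/-- The law of `(X₁, …, Xₙ)` when the chain starts at `X₀ = x`. -/
def pathLaw (P : X → PMF X) : ℕ → X → PMF (List X)
  | 0, _ => PMF.pure []
  | n + 1, x => (P x).bind fun z => (pathLaw P n z).map fun w => z :: w

/-- `ℙ_x (τ_y ≤ n)`, where `τ_y = min {k ≥ 1 | X_k = y}` (`τ_y = ∞` if there is no such `k`). -/
def returnBy (P : X → PMF X) (x y : X) (n : ℕ) : ℝ≥0∞ :=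
  (pathLaw P n x).toOuterMeasure {w | y ∈ w}

/-- `ℙ_x (τ_y > n)`. -/
def avoidUpTo (P : X → PMF X) (x y : X) (n : ℕ) : ℝ≥0∞ :=
  (pathLaw P n x).toOuterMeasure {w | y ∉ w}

/-- `ℙ_x (τ_y < ∞)`, the limit of the increasing sequence `ℙ_x (τ_y ≤ n)`. -/
def returnProb (P : X → PMF X) (x y : X) : ℝ≥0∞ := ⨆ n, returnBy P x y n

/-- `𝔼_x τ_y = ∑_{n ≥ 0} ℙ_x (τ_y > n)`. -/
def meanReturnTime (P : X → PMF X) (x y : X) : ℝ≥0∞ := ∑' n, avoidUpTo P x y n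

/-- Positive recurrence, for a chain that need not be irreducible on the whole state space:
there is a state whose mean return time is finite and which is reached in finite mean time from
every initial state. So the states that communicate with it form the only recurrent class, this
class is positive recurrent, and for an irreducible chain this is the usual notion. -/
def IsPositiveRecurrent (P : X → PMF X) : Prop :=
  ∃ y, ∀ x, meanReturnTime P x y < ∞

/-- Transience: every state is transient. -/
def IsTransient (P : X → PMF X) : Prop :=
  ∀ x, returnProb P x x < 1

def IsStationary (P : X → PMF X) (π : PMF X) : Prop := π.bind P = π

end DiscreteChain

/-- The data of the multi-access system with `L` service requirement classes and `J` received
power classes. -/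
structure MultiAccess (L J : ℕ) where
  /-- the parameter of the random coding bound -/
  ρ : ℝ
  /-- the noise power spectral density -/
  N₀ : ℝ
  /-- the bandwidth -/
  W : ℝ
  /-- the received power of class `(·, j)` -/
  P : Fin J → ℝ
  /-- the tolerable error probability of class `(l, ·)` -/
  Pe : Fin L → ℝ
  /-- the message alphabet size of class `(l, ·)` -/
  M : Fin L → ℕ
  /-- the law of the number `A l j` of class `(l, j)` messages arriving in a slot -/
  p : Fin L → Fin J → PMF ℕ
  ρ_pos : 0 < ρ
  ρ_le_one : ρ ≤ 1
  N₀_pos : 0 < N₀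
  W_pos : 0 < W
  P_pos : ∀ j, 0 < P j
  Pe_pos : ∀ l, 0 < Pe l
  Pe_lt_one : ∀ l, Pe l < 1
  M_pos : ∀ l, 1 ≤ M l
  /-- `𝔼 A²` is finite (hence so is `𝔼 A`) -/
  secondMoment_finite : ∀ l j, ∑' k : ℕ, p l j k * (k : ℝ≥0∞) ^ 2 < ∞

namespace MultiAccess

variable {L J : ℕ} (m : MultiAccess L J) (K : ℕ)

/-- The service requirement of a class `(l, ·)` message. -/
def S (l : Fin L) : ℝ := -Real.log (m.Pe l) + m.ρ * Real.log (m.M l)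

/-- The mean number `𝔼 A l j` of class `(l, j)` messages arriving in a slot. -/
def EA (l : Fin L) (j : Fin J) : ℝ := ∑' k : ℕ, (m.p l j k).toReal * k

/-- Service quantum of a message received at power `Pm` with effective noise variance `v`. -/
def E₀ (Pm v : ℝ) : ℝ := m.ρ * Real.log (1 + Pm / ((1 + m.ρ) * v))

/-- Service quantum per class `(·, j)` message when `s l j` messages of each class `(l, j)` are
transmitted: all the other transmitted messages are noise to it. It is `0` if no class `(·, j)`
message is transmitted. -/
def φ (j : Fin J) (s : Fin L → Fin J → ℕ) : ℝ :=
  if 0 < ∑ l, s l j then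
    m.E₀ (m.P j) (m.N₀ * m.W + (∑ l', ∑ j', (s l' j' : ℝ) * m.P j') - m.P j)
  else 0

/-- The minimum of `φ j s` over the schedules `s` of exactly `K` messages, at least one of which
has class `(·, j)`. (This set of schedules is finite, and nonempty for `L, K ≥ 1`.) -/
def φMin (j : Fin J) : ℝ :=
  sInf (m.φ j '' {s | ∑ l, ∑ j', s l j' = K ∧ 0 < ∑ l, s l j})

/-- The schedules of at most `K` simultaneous transmissions. -/
def Schedule (L J K : ℕ) : Type := {s : Fin L → Fin J → ℕ // ∑ l, ∑ j, s l j ≤ K}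

/-- The possible residual service requirements of class `(l, j)` messages present in the system. -/
inductive IsResidual (l : Fin L) (j : Fin J) : ℝ → Prop
  | fresh : IsResidual l j (m.S l)
  | served {x : ℝ} (s : Schedule L J K) : IsResidual l j x → m.φ j s.1 < x →
      IsResidual l j (x - m.φ j s.1)

/-- A message present in the system. -/
structure Message where
  /-- the residual service requirement -/
  x : ℝ
  /-- the service requirement class -/
  l : Fin L
  /-- the received power class -/
  j : Fin J
  isResidual : IsResidual m K l j x

/-- The states of the chain: finite vectors of messages. -/
abbrev State : Type := List (Message m K)

variable {m K}

/-- The number of class `(l, j)` messages in a state. -/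
def count (α : State m K) (l : Fin L) (j : Fin J) : ℕ :=
  α.countP fun a => a.l = l ∧ a.j = j

/-- The message after one slot of transmission under schedule `s`; it leaves the system (`none`)
when its requirement is met. -/
def Message.serve (a : Message m K) (s : Schedule L J K) : Option (Message m K) :=
  if h : m.φ a.j s.1 < a.x then
    some ⟨a.x - m.φ a.j s.1, a.l, a.j, IsResidual.served s a.isResidual h⟩
  else none

/-- The messages left at the end of a slot in which those with positions in `I` are transmitted
under schedule `s`. -/
def transmit (α : State m K) (s : Schedule L J K) (I : Finset (Fin α.length)) : State m K :=
  (List.finRange α.length).filterMap fun k =>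
    if k ∈ I then (α.get k).serve s else some (α.get k)

variable (m K)

/-- The law of the new messages of the classes in a list: the numbers of arrivals of the different
classes are independent. -/
def arrivalsOf : List (Fin L × Fin J) → PMF (State m K)
  | [] => PMF.pure []
  | c :: cs => (m.p c.1 c.2).bind fun k => (arrivalsOf cs).map fun rest =>
      List.replicate k ⟨m.S c.1, c.1, c.2, IsResidual.fresh⟩ ++ rest

/-- The law of the batch of messages arriving in a slot. -/
def arrivals : PMF (State m K) := arrivalsOf m K (List.finRange L ×ˢ List.finRange J)

variable {m K}

/-- The schedules that can be implemented in state `α`. -/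
def Implementable (α : State m K) (s : Schedule L J K) : Prop :=
  ∀ l j, s.1 l j ≤ count α l j

variable (m K)

/-- A (deterministic or random) non-idling scheduling policy: in each state it draws an
implementable schedule which transmits as many messages as possible, up to `K`. -/
structure NonIdlingPolicy where
  law : State m K → PMF (Schedule L J K)
  implementable : ∀ α, ∀ s ∈ (law α).support, Implementable α s
  nonIdling : ∀ α, ∀ s ∈ (law α).support, ∑ l, ∑ j, s.1 l j = min K α.length

/-- A schedule fixes only how many messages of each class are transmitted. A selection rule
completes it: it draws which ones (by their positions in the state vector), in an arbitrary,
possibly random, manner. -/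
structure SelectionRule where
  law : (α : State m K) → Schedule L J K → PMF (Finset (Fin α.length))
  card_eq : ∀ α s, Implementable α s → ∀ I ∈ (law α s).support, ∀ l j,
    (I.filter fun k => (α.get k).l = l ∧ (α.get k).j = j).card = s.1 l j

variable {m K}

/-- The transition law of the chain: a schedule and the messages to transmit are drawn, these
messages are served for one slot, and the batch of new messages joins at the slot boundary. -/
def transition (ω : NonIdlingPolicy m K) (r : SelectionRule m K) (α : State m K) :
    PMF (State m K) :=
  (ω.law α).bind fun s => (r.law α s).bind fun I =>
    (arrivals m K).map fun new => transmit α s I ++ new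

end MultiAccess

end

/-! For `K = 1` a transmitted message meets no interference, so its quantum depends only on its
power class and equals `φMin`. Hence a message with residual `x` needs exactly `⌈x / φMin⌉` slots,
whatever the policy and the selection rule. The total `work` drops by one in each slot that starts
in a nonempty state and grows by an independent batch `B` whose mean is the load: it is the walk `V
↦ (V - 1)⁺ + B` (`work_transmit`, `expect_transition`). It vanishes only in the empty state.

If the load is below one, a quadratic Lyapunov function of the work has drift at most a negative
multiple of the work (`PMF.exists_lyapunov`). Foster's criterion then bounds both the mean time to
reach the empty state and the mean work accumulated over an excursion from it. The normalized
occupation measure of an excursion is the only stationary law, and the work dominates every message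
count.

If the load exceeds one, the generating function of `B` satisfies `𝔼 θ ^ B ≤ θ` for some `θ < 1`
(`PMF.exists_expect_pow_le`). Then `θ ^ (work z - work x)⁺` is superharmonic in `z`, equals one at
`x`, and has mean below one after one step from `x`; this bounds the return probability to `x`.
Irreducibility is never needed. -/

namespace PMF

/-! ### Expectations with values in `[0, ∞]` -/

variable {X Y : Type*}

/-- The expectation of a nonnegative function. -/
noncomputable def expect (p : PMF X) (f : X → ℝ≥0∞) : ℝ≥0∞ := ∑' x, p x * f x

theorem expect_pure (x : X) (f : X → ℝ≥0∞) : (PMF.pure x).expect f = f x := by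
  classical
  unfold expect
  rw [tsum_eq_single x]
  · simp
  · intro z hz
    simp [hz]

theorem expect_bind (p : PMF X) (q : X → PMF Y) (f : Y → ℝ≥0∞) :
    (p.bind q).expect f = p.expect fun x => (q x).expect f := by
  simp only [expect, PMF.bind_apply, ← ENNReal.tsum_mul_right, ← ENNReal.tsum_mul_left]
  rw [ENNReal.tsum_comm]
  simp only [mul_assoc]

theorem expect_map (p : PMF X) (g : X → Y) (f : Y → ℝ≥0∞) :
    (p.map g).expect f = p.expect fun x => f (g x) := by
  have : p.map g = p.bind fun x => PMF.pure (g x) := rfl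
  rw [this, expect_bind]
  simp only [expect_pure]

theorem expect_mono_of_support {p : PMF X} {f g : X → ℝ≥0∞} (h : ∀ x ∈ p.support, f x ≤ g x) :
    p.expect f ≤ p.expect g := by
  refine ENNReal.tsum_le_tsum fun x => ?_
  by_cases hx : p x = 0
  · simp [hx]
  · gcongr
    exact h x ((p.mem_support_iff x).2 hx)

theorem expect_mono {p : PMF X} {f g : X → ℝ≥0∞} (h : ∀ x, f x ≤ g x) :
    p.expect f ≤ p.expect g :=
  expect_mono_of_support fun x _ => h x

theorem expect_congr_of_support {p : PMF X} {f g : X → ℝ≥0∞}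
    (h : ∀ x ∈ p.support, f x = g x) : p.expect f = p.expect g :=
  le_antisymm (expect_mono_of_support fun x hx => (h x hx).le)
    (expect_mono_of_support fun x hx => (h x hx).ge)

theorem expect_const (p : PMF X) (c : ℝ≥0∞) : (p.expect fun _ => c) = c := by
  simp [expect, ENNReal.tsum_mul_right, p.tsum_coe]

theorem expect_add (p : PMF X) (f g : X → ℝ≥0∞) :
    (p.expect fun x => f x + g x) = p.expect f + p.expect g := by
  simp only [expect, mul_add, ENNReal.tsum_add]

theorem expect_const_mul (p : PMF X) (c : ℝ≥0∞) (f : X → ℝ≥0∞) :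
    (p.expect fun x => c * f x) = c * p.expect f := by
  simp only [expect, ← ENNReal.tsum_mul_left]
  exact tsum_congr fun x => mul_left_comm _ _ _

theorem expect_tsum {ι : Type*} (p : PMF X) (f : ι → X → ℝ≥0∞) :
    (p.expect fun x => ∑' i, f i x) = ∑' i, p.expect (f i) := by
  simp only [expect, ← ENNReal.tsum_mul_left]
  exact ENNReal.tsum_comm

theorem expect_lt_one {p : PMF X} {f : X → ℝ≥0∞} (hf : ∀ x, f x ≤ 1) {x : X}
    (hx : x ∈ p.support) (hlt : f x < 1) : p.expect f < 1 := by
  have h1 : p.expect f ≤ ∑' z, p z := ENNReal.tsum_le_tsum fun z => mul_le_of_le_one_right' (hf z)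
  rw [p.tsum_coe] at h1
  calc p.expect f < ∑' z, p z := by
        refine ENNReal.tsum_lt_tsum (i := x) (ne_top_of_le_ne_top ENNReal.one_ne_top h1)
          (fun z => mul_le_of_le_one_right' (hf z)) ?_
        calc p x * f x < p x * 1 :=
              (ENNReal.mul_lt_mul_iff_right ((p.mem_support_iff x).1 hx) (p.apply_ne_top x)).2 hlt
          _ = p x := mul_one _
    _ = 1 := p.tsum_coe

/-- Two laws that agree off one point are equal. -/
theorem ext_of_ne {p q : PMF X} (y : X) (h : ∀ z, z ≠ y → p z = q z) : p = q := by
  classical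
  ext z
  by_cases hz : z = y
  · subst hz
    have hp := p.tsum_coe
    have hq := q.tsum_coe
    rw [ENNReal.tsum_eq_add_tsum_ite z] at hp hq
    have e : (∑' x, if x = z then 0 else p x) = ∑' x, if x = z then 0 else q x := by
      refine tsum_congr fun x => ?_
      split_ifs with hx
      · rfl
      · exact h x hx
    rw [e, ← hq] at hp
    refine (ENNReal.add_left_inj ?_).1 hp
    exact ne_top_of_le_ne_top ENNReal.one_ne_top (hq ▸ le_add_self)
  · exact h z hz

end PMF

/-! ### Return times, superharmonic functions and Foster's criterion -/

namespace DiscreteChain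

open Classical Filter Topology

variable {X : Type*} (P : X → PMF X) (y : X)

theorem avoidUpTo_zero (x : X) : avoidUpTo P x y 0 = 1 := by
  simp [avoidUpTo, pathLaw, PMF.toOuterMeasure_pure_apply]

/-- One step of the chain killed at `y`, acting on functions. -/
noncomputable def taboo (f : X → ℝ≥0∞) (x : X) : ℝ≥0∞ :=
  (P x).expect fun z => if z = y then 0 else f z

theorem taboo_le_expect (f : X → ℝ≥0∞) (x : X) : taboo P y f x ≤ (P x).expect f :=
  PMF.expect_mono fun z => by split_ifs <;> simp

theorem taboo_mono {f g : X → ℝ≥0∞} (h : ∀ z, z ≠ y → f z ≤ g z) (x : X) :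
    taboo P y f x ≤ taboo P y g x :=
  PMF.expect_mono fun z => by
    split_ifs with hz
    · rfl
    · exact h z hz

theorem taboo_tsum {ι : Type*} (f : ι → X → ℝ≥0∞) (x : X) :
    taboo P y (fun z => ∑' i, f i z) x = ∑' i, taboo P y (f i) x := by
  unfold taboo
  rw [← PMF.expect_tsum]
  congr 1
  funext z
  split_ifs <;> simp

theorem avoidUpTo_succ (x : X) (n : ℕ) :
    avoidUpTo P x y (n + 1) = taboo P y (fun z => avoidUpTo P z y n) x := by
  unfold avoidUpTo taboo PMF.expect
  rw [pathLaw, PMF.toOuterMeasure_bind_apply]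
  refine tsum_congr fun z => ?_
  rw [PMF.toOuterMeasure_map_apply]
  congr 1
  beta_reduce
  split_ifs with hz
  · subst hz
    simp
  · simp [Set.preimage, Ne.symm hz]

/-- Makes the mean return time the total reward of the killed chain with reward `1`, the case of
Foster's criterion that gives recurrence. -/
theorem avoidUpTo_eq_iterate (x : X) (n : ℕ) :
    avoidUpTo P x y n = (taboo P y)^[n] (fun _ => 1) x := by
  induction n generalizing x with
  | zero => simp [avoidUpTo_zero]
  | succ n ih =>
    rw [avoidUpTo_succ, Function.iterate_succ_apply']
    congr 1
    funext z
    exact ih z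

theorem returnBy_zero (x : X) : returnBy P x y 0 = 0 := by
  simp [returnBy, pathLaw, PMF.toOuterMeasure_pure_apply]

theorem returnBy_succ (x : X) (n : ℕ) :
    returnBy P x y (n + 1) = (P x).expect fun z => if z = y then 1 else returnBy P z y n := by
  unfold returnBy PMF.expect
  rw [pathLaw, PMF.toOuterMeasure_bind_apply]
  refine tsum_congr fun z => ?_
  rw [PMF.toOuterMeasure_map_apply]
  congr 1
  beta_reduce
  split_ifs with hz
  · subst hz
    simp [Set.preimage, PMF.toOuterMeasure_apply, PMF.tsum_coe]
  · simp [Set.preimage, Ne.symm hz]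

/-- A superharmonic function that is at least `1` at `y` dominates the return probability. -/
theorem returnProb_le_expect {f : X → ℝ≥0∞} (hy : 1 ≤ f y) (hf : ∀ x, (P x).expect f ≤ f x)
    (x : X) : returnProb P x y ≤ (P x).expect f := by
  have key : ∀ n x, returnBy P x y n ≤ (P x).expect f := by
    intro n
    induction n with
    | zero => simp [returnBy_zero]
    | succ n ih =>
      intro x
      rw [returnBy_succ]
      refine PMF.expect_mono fun z => ?_
      split_ifs with hz
      · rwa [hz]
      · exact (ih z).trans (hf z)
  exact iSup_le fun n => key n x

theorem tsum_iterate_taboo (g : X → ℝ≥0∞) (x : X) :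
    ∑' n, (taboo P y)^[n] g x = g x + taboo P y (fun z => ∑' n, (taboo P y)^[n] g z) x := by
  rw [tsum_eq_zero_add' ENNReal.summable, taboo_tsum]
  simp only [Function.iterate_succ_apply', Function.iterate_zero_apply]

/-- Foster's criterion: a Lyapunov function bounds the expected reward collected before `y`. -/
theorem tsum_iterate_taboo_le {f g : X → ℝ≥0∞}
    (h : ∀ x, x ≠ y → (P x).expect f + g x ≤ f x) {x : X} (hx : x ≠ y) :
    ∑' n, (taboo P y)^[n] g x ≤ f x := by
  -- Truncating at `N` steps permits induction. The drift hypothesis is needed only off `y`, because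
  -- the killed chain never continues from `y`.
  rw [ENNReal.tsum_eq_iSup_nat]
  refine iSup_le fun N => ?_
  induction N generalizing x with
  | zero => simp
  | succ N ih =>
    rw [Finset.sum_range_succ']
    refine le_trans (add_le_add (?_ : _ ≤ (P x).expect f) le_rfl) (h x hx)
    refine le_trans ?_ ((taboo_mono P y (fun z hz => ih hz) x).trans (taboo_le_expect P y f x))
    simp only [Function.iterate_succ_apply']
    -- The finite sum becomes a `tsum` over a subtype so that `taboo_tsum` provides additivity.
    rw [← Finset.tsum_subtype (Finset.range N) fun i => taboo P y ((taboo P y)^[i] g) x,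
      ← taboo_tsum]
    exact taboo_mono P y (fun z _ =>
      (Finset.tsum_subtype (Finset.range N) fun i => (taboo P y)^[i] g z).le) x

/-- No drift is available at `y`, so the first step is split off and Foster's bound is applied from
the next state on. -/
theorem tsum_iterate_taboo_self_le {f g : X → ℝ≥0∞}
    (h : ∀ x, x ≠ y → (P x).expect f + g x ≤ f x) :
    ∑' n, (taboo P y)^[n] g y ≤ g y + (P y).expect f := by
  rw [tsum_iterate_taboo]
  gcongr
  exact (taboo_mono P y (fun z hz => tsum_iterate_taboo_le P y h hz) y).trans
    (taboo_le_expect P y f y)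

/-! ### Excursions and the stationary law -/

/-- One step of the chain killed at `y`, acting on measures. -/
noncomputable def push (μ : X → ℝ≥0∞) (z : X) : ℝ≥0∞ :=
  if z = y then 0 else ∑' x, μ x * P x z

/-- `push` and `taboo` are adjoint, by Tonelli. This converts sums against the occupation measure
into rewards along an excursion. -/
theorem tsum_push_mul (μ f : X → ℝ≥0∞) :
    ∑' z, push P y μ z * f z = ∑' x, μ x * taboo P y f x := by
  simp only [taboo, PMF.expect, ← ENNReal.tsum_mul_left]
  rw [ENNReal.tsum_comm]
  refine tsum_congr fun z => ?_
  unfold push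
  split_ifs with hz
  · simp
  · simp only [← ENNReal.tsum_mul_right, mul_assoc]

theorem tsum_iterate_push_mul (μ f : X → ℝ≥0∞) (n : ℕ) :
    ∑' z, (push P y)^[n] μ z * f z = ∑' x, μ x * (taboo P y)^[n] f x := by
  induction n generalizing f with
  | zero => rfl
  | succ n ih => rw [Function.iterate_succ_apply', tsum_push_mul, ih, ← Function.iterate_succ_apply]

theorem tsum_push {ι : Type*} (μ : ι → X → ℝ≥0∞) (z : X) :
    push P y (fun x => ∑' i, μ i x) z = ∑' i, push P y (μ i) z := by
  unfold push
  split_ifs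
  · simp
  · simp only [← ENNReal.tsum_mul_right]
    exact ENNReal.tsum_comm

theorem push_add (μ ν : X → ℝ≥0∞) : push P y (μ + ν) = push P y μ + push P y ν := by
  funext z
  simp only [push, Pi.add_apply]
  split_ifs
  · simp
  · simp only [add_mul, ENNReal.tsum_add]

theorem push_const_mul (c : ℝ≥0∞) (μ : X → ℝ≥0∞) :
    push P y (fun x => c * μ x) = fun z => c * push P y μ z := by
  funext z
  simp only [push]
  split_ifs
  · simp
  · simp only [mul_assoc, ENNReal.tsum_mul_left]

/-- The expected number of visits before the return to `y`, starting from `y`. -/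
noncomputable def occupation (z : X) : ℝ≥0∞ := ∑' n, (push P y)^[n] (PMF.pure y) z

theorem tsum_occupation_mul (f : X → ℝ≥0∞) :
    ∑' z, occupation P y z * f z = ∑' n, (taboo P y)^[n] f y := by
  simp only [occupation, ← ENNReal.tsum_mul_right]
  rw [ENNReal.tsum_comm]
  refine tsum_congr fun n => ?_
  rw [tsum_iterate_push_mul]
  exact PMF.expect_pure y _

theorem tsum_occupation : ∑' z, occupation P y z = meanReturnTime P y y := by
  have := tsum_occupation_mul P y fun _ => 1
  simpa only [mul_one, meanReturnTime, avoidUpTo_eq_iterate] using this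

theorem occupation_eq (z : X) :
    occupation P y z = PMF.pure y z + push P y (occupation P y) z := by
  have e : push P y (occupation P y) z = ∑' n, push P y ((push P y)^[n] (PMF.pure y)) z :=
    tsum_push P y _ z
  rw [e, occupation, tsum_eq_zero_add' ENNReal.summable]
  simp only [Function.iterate_succ_apply', Function.iterate_zero_apply]

theorem one_le_meanReturnTime (x : X) : 1 ≤ meanReturnTime P x y :=
  (avoidUpTo_zero P y x).ge.trans (ENNReal.le_tsum 0)

/-- The occupation measure of an excursion from `y`, normalized. -/
noncomputable def excursionLaw (h : meanReturnTime P y y < ∞) : PMF X :=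
  PMF.normalize (occupation P y)
    (by rw [tsum_occupation]; exact (zero_lt_one.trans_le (one_le_meanReturnTime P y y)).ne')
    (by rw [tsum_occupation]; exact h.ne)

theorem excursionLaw_apply (h : meanReturnTime P y y < ∞) (z : X) :
    excursionLaw P y h z = occupation P y z * (meanReturnTime P y y)⁻¹ := by
  rw [excursionLaw, PMF.normalize_apply, tsum_occupation]

/-- Off `y`, `occupation_eq` is the invariance equation. At `y` nothing remains to be checked, since
both sides have mass one. -/
theorem isStationary_excursionLaw (h : meanReturnTime P y y < ∞) :
    IsStationary P (excursionLaw P y h) := by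
  refine PMF.ext_of_ne y fun z hz => ?_
  rw [PMF.bind_apply, excursionLaw_apply, occupation_eq, PMF.pure_apply, if_neg hz, zero_add, push,
    if_neg hz, ← ENNReal.tsum_mul_right]
  refine tsum_congr fun x => ?_
  rw [excursionLaw_apply]
  ring

/-- Last-exit decomposition: the paths of the stationary chain are split by their last visit to `y`,
the remainder being those that avoid `y` for `n` steps. It iterates `π = π y • δ_y + push π`. -/
theorem IsStationary.eq_add_iterate_push {π : PMF X} (hπ : IsStationary P π) (n : ℕ) (z : X) :
    π z = π y * (∑ k ∈ Finset.range n, (push P y)^[k] (PMF.pure y) z) + (push P y)^[n] π z := by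
  have step : (π : X → ℝ≥0∞) = (fun z => π y * PMF.pure y z) + push P y π := by
    funext z
    rw [Pi.add_apply, PMF.pure_apply, push]
    split_ifs with hz
    · simp [hz]
    · rw [mul_zero, zero_add, ← PMF.bind_apply, hπ]
  have key : ∀ n, (push P y)^[n] π
      = (fun z => π y * (push P y)^[n] (PMF.pure y) z) + (push P y)^[n + 1] π := by
    intro n
    induction n with
    | zero => exact step
    | succ n ih =>
      rw [Function.iterate_succ_apply', ih, push_add, push_const_mul,
        ← Function.iterate_succ_apply' (push P y), ← Function.iterate_succ_apply' (push P y)]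
  induction n with
  | zero => simp
  | succ n ih =>
    conv_lhs => rw [ih, key n]
    rw [Pi.add_apply, Finset.sum_range_succ, mul_add, add_assoc]

/-- Terms of a convergent series tend to zero for each `x`; dominated convergence with majorant `π`
does the rest. -/
theorem tendsto_tsum_mul_avoidUpTo (h : ∀ x, meanReturnTime P x y < ∞) (π : PMF X) :
    Tendsto (fun n => ∑' x, π x * avoidUpTo P x y n) atTop (𝓝 0) := by
  let _ : MeasurableSpace X := ⊤
  have hle : ∀ n x, avoidUpTo P x y n ≤ 1 := by
    intro n
    induction n with
    | zero => intro x; rw [avoidUpTo_zero]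
    | succ n ih =>
      intro x
      rw [avoidUpTo_succ]
      exact (taboo_le_expect P y _ x).trans
        ((PMF.expect_mono ih).trans (PMF.expect_const (P x) 1).le)
  have := MeasureTheory.tendsto_lintegral_of_dominated_convergence
    (μ := MeasureTheory.Measure.count) (F := fun n x => π x * avoidUpTo P x y n)
    (f := fun _ => 0) (fun x => π x) (fun n => measurable_from_top)
    (fun n => Eventually.of_forall fun x => mul_le_of_le_one_right' (hle n x))
    (by rw [MeasureTheory.lintegral_count, π.tsum_coe]; exact ENNReal.one_ne_top)
    (Eventually.of_forall fun x => by
      have := ENNReal.Tendsto.const_mul (a := π x)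
        (ENNReal.tendsto_atTop_zero_of_tsum_ne_top (h x).ne) (Or.inr (π.apply_ne_top x))
      simpa using this)
  simpa only [MeasureTheory.lintegral_count, tsum_zero] using this

/-- If `y` is reached in finite mean time from everywhere, then the stationary law is unique. -/
theorem IsStationary.eq_excursionLaw (h : ∀ x, meanReturnTime P x y < ∞) {π : PMF X}
    (hπ : IsStationary P π) : π = excursionLaw P y (h y) := by
  have key : ∀ z, π z = π y * occupation P y z := by
    intro z
    have h1 : Tendsto (fun n => π y * (∑ k ∈ Finset.range n, (push P y)^[k] (PMF.pure y) z)
        + (push P y)^[n] π z) atTop (𝓝 (π y * occupation P y z + 0)) := by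
      refine Tendsto.add (ENNReal.Tendsto.const_mul (ENNReal.tendsto_nat_tsum _)
        (Or.inr (π.apply_ne_top y))) ?_
      -- The remainder at `z` is at most its total mass, which by duality is the probability of
      -- avoiding `y` for `n` steps from `π`.
      refine tendsto_of_tendsto_of_tendsto_of_le_of_le tendsto_const_nhds
        (tendsto_tsum_mul_avoidUpTo P y h π) (fun n => zero_le) fun n => ?_
      simp only [avoidUpTo_eq_iterate]
      rw [← tsum_iterate_push_mul]
      simpa only [mul_one] using ENNReal.le_tsum (f := (push P y)^[n] π) z
    have h2 := h1.congr fun n => (hπ.eq_add_iterate_push P y n z).symm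
    simpa using tendsto_nhds_unique tendsto_const_nhds h2
  have h1 : π y * meanReturnTime P y y = 1 := by
    rw [← π.tsum_coe, ← tsum_occupation, ← ENNReal.tsum_mul_left]
    exact tsum_congr fun z => (key z).symm
  ext z
  rw [key z, excursionLaw_apply, ENNReal.eq_inv_of_mul_eq_one_left h1, mul_comm]

end DiscreteChain

/-! ### The work in the system and its decrease by one per slot -/

theorem List.sum_map_filterMap {A B : Type*} (l : List A) (f : A → Option B) (g : B → ℕ) :
    ((l.filterMap f).map g).sum = (l.map fun a => (f a).elim 0 g).sum := by
  induction l with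
  | nil => rfl
  | cons a l ih =>
    rw [List.filterMap_cons]
    cases h : f a <;> simp [h, ih]

namespace MultiAccess

variable {L J : ℕ} (m : MultiAccess L J)

/-- The service quantum of a message that is transmitted alone. -/
noncomputable def soloQuantum (j : Fin J) : ℝ := m.E₀ (m.P j) (m.N₀ * m.W)

theorem soloQuantum_pos (j : Fin J) : 0 < m.soloQuantum j := by
  have h1 := m.ρ_pos
  have h2 := m.N₀_pos
  have h3 := m.W_pos
  have h4 := m.P_pos j
  have h5 : 0 < m.P j / ((1 + m.ρ) * (m.N₀ * m.W)) := by positivity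
  exact mul_pos h1 (Real.log_pos (by linarith))

/-- The total received power is that of the single message, so subtracting it leaves only the noise.
-/
theorem φ_eq_soloQuantum {s : Fin L → Fin J → ℕ} (hs : ∑ l, ∑ j, s l j = 1) {j : Fin J}
    (hj : 0 < ∑ l, s l j) : m.φ j s = m.soloQuantum j := by
  rw [Finset.sum_comm] at hs
  have hsplit := Finset.add_sum_erase Finset.univ (fun j' => ∑ l, s l j') (Finset.mem_univ j)
  have hj1 : ∑ l, s l j = 1 := by
    omega
  have h0 : ∀ j', j' ≠ j → ∑ l, s l j' = 0 := by
    intro j' hne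
    have : ∑ j' ∈ Finset.univ.erase j, ∑ l, s l j' = 0 := by
      omega
    exact (Finset.sum_eq_zero_iff.1 this) j' (Finset.mem_erase.2 ⟨hne, Finset.mem_univ _⟩)
  have hP : ∑ l', ∑ j', (s l' j' : ℝ) * m.P j' = m.P j := by
    rw [Finset.sum_comm]
    simp only [← Finset.sum_mul, ← Nat.cast_sum]
    rw [Finset.sum_eq_single j (fun j' _ hne => by rw [h0 j' hne]; simp) (by simp), hj1]
    simp
  rw [φ, if_pos hj, hP, soloQuantum, add_sub_cancel_right]

/-- The class `l` only witnesses that some schedule exists; over the empty set `sInf` would be `0`.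
-/
theorem φMin_one (l : Fin L) (j : Fin J) : m.φMin 1 j = m.soloQuantum j := by
  have : m.φ j '' {s | ∑ l, ∑ j', s l j' = 1 ∧ 0 < ∑ l, s l j} = {m.soloQuantum j} := by
    refine Set.Subset.antisymm ?_ ?_
    · rintro _ ⟨s, hs, rfl⟩
      exact m.φ_eq_soloQuantum hs.1 hs.2
    · rintro _ rfl
      have h : (∑ l', ∑ j', if l' = l then if j' = j then 1 else 0 else 0) = 1 ∧
          0 < ∑ l', if l' = l then if j = j then 1 else 0 else 0 := by
        constructor
        · rw [Finset.sum_eq_single l (by intro b _ hb; simp [hb]) (by simp)]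
          simp
        · simp
      exact ⟨fun l' j' => if l' = l then if j' = j then 1 else 0 else 0, h,
        m.φ_eq_soloQuantum h.1 h.2⟩
  rw [φMin, this, csInf_singleton]

theorem S_pos (l : Fin L) : 0 < m.S l := by
  have h1 := Real.log_neg (m.Pe_pos l) (m.Pe_lt_one l)
  have h2 := mul_nonneg m.ρ_pos.le (Real.log_natCast_nonneg (m.M l))
  rw [S]
  linarith

variable {m}

theorem IsResidual.pos {K : ℕ} {l : Fin L} {j : Fin J} {x : ℝ} (h : IsResidual m K l j x) :
    0 < x := by
  cases h with
  | fresh => exact m.S_pos l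
  | served s _ h => exact sub_pos.2 h

/-- The number of slots that a message has to be transmitted alone. -/
noncomputable def Message.work (a : Message m 1) : ℕ := ⌈a.x / m.φMin 1 a.j⌉₊

/-- The total number of slots required by the messages of a state. -/
noncomputable def work (α : State m 1) : ℕ := (α.map Message.work).sum

theorem Message.work_pos (a : Message m 1) : 0 < a.work := by
  rw [work, Nat.ceil_pos, m.φMin_one a.l]
  exact div_pos a.isResidual.pos (m.soloQuantum_pos _)

theorem work_append (α β : State m 1) : work (α ++ β) = work α + work β := by
  simp [work]

theorem length_le_work (α : State m 1) : α.length ≤ work α := by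
  have := List.card_nsmul_le_sum (α.map Message.work) 1 (by
    simp only [List.mem_map]
    rintro _ ⟨a, -, rfl⟩
    exact a.work_pos)
  simpa [work] using this

theorem count_le_work (α : State m 1) (l : Fin L) (j : Fin J) : count α l j ≤ work α :=
  List.countP_le_length.trans (length_le_work α)

theorem work_pos {α : State m 1} (h : α ≠ []) : 1 ≤ work α :=
  (List.length_pos_iff.2 h).trans_le (length_le_work α)

/-- Subtracting one quantum lowers the quotient, hence its ceiling, by one; a departing message has
quotient in `(0, 1]`, hence ceiling one. -/
theorem Message.work_serve (a : Message m 1) {s : Schedule L J 1}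
    (hs : ∑ l, ∑ j, s.1 l j = 1) (hj : 0 < ∑ l, s.1 l a.j) :
    (a.serve s).elim 0 Message.work + 1 = a.work := by
  have hφ := m.φ_eq_soloQuantum hs hj
  have hq := m.soloQuantum_pos a.j
  have hw := a.work_pos
  unfold Message.serve
  split_ifs with h
  · simp only [Option.elim_some, Message.work, m.φMin_one a.l] at hw ⊢
    rw [hφ, sub_div, div_self hq.ne', Nat.ceil_sub_one]
    omega
  · simp only [Option.elim_none, Message.work, m.φMin_one a.l] at hw ⊢
    have : ⌈a.x / m.soloQuantum a.j⌉₊ ≤ 1 := by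
      rw [Nat.ceil_le, Nat.cast_one, div_le_one hq, ← hφ]
      exact not_lt.1 h
    omega

theorem work_transmit {α : State m 1} {s : Schedule L J 1} {I : Finset (Fin α.length)}
    (h : ∀ l j, (I.filter fun k => (α.get k).l = l ∧ (α.get k).j = j).card = s.1 l j) :
    work (transmit α s I) + ∑ l, ∑ j, s.1 l j = work α := by
  have hcard : I.card = ∑ l, ∑ j, s.1 l j := by
    rw [Finset.card_eq_sum_card_fiberwise (f := fun k => ((α.get k).l, (α.get k).j))
      (t := Finset.univ) (fun _ _ => Finset.mem_coe.2 (Finset.mem_univ _)),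
      Fintype.sum_prod_type]
    simp only [Prod.mk.injEq, h]
  have hα : work α = ∑ k, (α.get k).work := by
    rw [Fin.sum_univ_def, work]
    conv_lhs => rw [← List.map_get_finRange α, List.map_map]
    rfl
  rw [← hcard, hα, work, transmit, List.sum_map_filterMap, ← Fin.sum_univ_def,
    Finset.card_eq_sum_ones]
  have hI : ∑ x ∈ I, 1 = ∑ k, if k ∈ I then 1 else 0 := by
    rw [Finset.sum_ite_mem, Finset.univ_inter]
  rw [hI, ← Finset.sum_add_distrib]
  refine Finset.sum_congr rfl fun k _ => ?_
  split_ifs with hk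
  -- A selected position makes its class entry positive; as the schedule has at most one message in
  -- all, it has exactly one.
  · have hkc : 0 < s.1 (α.get k).l (α.get k).j := by
      rw [← h]
      exact Finset.card_pos.2 ⟨k, Finset.mem_filter.2 ⟨hk, rfl, rfl⟩⟩
    have hcol : s.1 (α.get k).l (α.get k).j ≤ ∑ l, s.1 l (α.get k).j :=
      Finset.single_le_sum (f := fun l => s.1 l (α.get k).j) (fun _ _ => Nat.zero_le _)
        (Finset.mem_univ _)
    have htot : ∑ l, s.1 l (α.get k).j ≤ ∑ l, ∑ j, s.1 l j :=
      Finset.sum_le_sum fun l _ =>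
        Finset.single_le_sum (f := fun j => s.1 l j) (fun _ _ => Nat.zero_le _)
          (Finset.mem_univ _)
    have hs := s.2
    exact (α.get k).work_serve (by omega) (by omega)
  · rfl

/-! ### The law of the work arriving in a slot, and its moments -/

variable (m)

/-- The law of the number of slots required by the messages that arrive in a slot. -/
noncomputable def workload : PMF ℕ := (arrivals m 1).map work

variable {m}

/-- The total work is a random walk with steps `workload - 1`, reflected at zero. -/
theorem expect_transition (ω : NonIdlingPolicy m 1) (r : SelectionRule m 1) (g : ℕ → ℝ≥0∞)
    (α : State m 1) : ((transition ω r α).expect fun β => g (work β))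
      = (workload m).expect fun k => g (work α - 1 + k) := by
  -- The new work does not depend on the schedule or the selection drawn, so these two averages are
  -- of constants.
  rw [transition, PMF.expect_bind, ← PMF.expect_const (ω.law α) ((workload m).expect _)]
  refine PMF.expect_congr_of_support fun s hs => ?_
  rw [PMF.expect_bind, ← PMF.expect_const (r.law α s) ((workload m).expect _)]
  refine PMF.expect_congr_of_support fun I hI => ?_
  rw [workload, PMF.expect_map, PMF.expect_map]
  have h1 := work_transmit (r.card_eq α s (ω.implementable α s hs) I hI)
  rw [ω.nonIdling α s hs] at h1
  have h2 : work (transmit α s I) = work α - 1 := by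
    -- In the empty state nothing is sent, and truncated subtraction gives the reflection `0 - 1 =
    -- 0`.
    rcases eq_or_ne α [] with rfl | hα
    · simp only [List.length_nil, Nat.min_zero] at h1
      rw [Nat.add_zero] at h1
      rw [h1]
      rfl
    · have := List.length_pos_iff.2 hα
      rw [min_eq_left this] at h1
      omega
  simp only [work_append, h2]

theorem expect_work_arrivalsOf (cs : List (Fin L × Fin J)) :
    ((arrivalsOf m 1 cs).expect fun α => (work α : ℝ≥0∞)) =
      (cs.map fun c => ((m.p c.1 c.2).expect fun k => (k : ℝ≥0∞)) *
        (⌈m.S c.1 / m.φMin 1 c.2⌉₊ : ℝ≥0∞)).sum := by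
  induction cs with
  | nil => simp [arrivalsOf, PMF.expect_pure, work]
  | cons c cs ih =>
    rw [arrivalsOf, PMF.expect_bind, List.map_cons, List.sum_cons, ← ih]
    simp only [PMF.expect_map, work_append, Nat.cast_add, PMF.expect_add, PMF.expect_const]
    congr 1
    rw [mul_comm, ← PMF.expect_const_mul]
    congr 1
    funext k
    simp [work, Message.work, mul_comm]

/-- The bound `(a + b)² ≤ 2a² + 2b²` avoids cross moments between classes. -/
theorem expect_work_sq_arrivalsOf (cs : List (Fin L × Fin J)) :
    ((arrivalsOf m 1 cs).expect fun α => (work α : ℝ≥0∞) ^ 2) < ∞ := by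
  induction cs with
  | nil => simp [arrivalsOf, PMF.expect_pure, work]
  | cons c cs ih =>
    rw [arrivalsOf, PMF.expect_bind]
    simp only [PMF.expect_map, work_append]
    set w : ℕ := ⌈m.S c.1 / m.φMin 1 c.2⌉₊
    have hw : ∀ k, work (List.replicate k (⟨m.S c.1, c.1, c.2, IsResidual.fresh⟩ : Message m 1))
        = k * w := fun k => by simp [work, Message.work, w]
    have hsq : ∀ a b : ℕ, ((a + b : ℕ) : ℝ≥0∞) ^ 2 ≤ 2 * (a : ℝ≥0∞) ^ 2 + 2 * (b : ℝ≥0∞) ^ 2 := by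
      intro a b
      have : (a + b) ^ 2 ≤ 2 * a ^ 2 + 2 * b ^ 2 := by
        zify
        nlinarith [sq_nonneg ((a : ℤ) - b)]
      exact_mod_cast this
    have hp : ((m.p c.1 c.2).expect fun k => (k : ℝ≥0∞) ^ 2) < ∞ := m.secondMoment_finite c.1 c.2
    calc _ ≤ (m.p c.1 c.2).expect fun k => (arrivalsOf m 1 cs).expect fun α =>
            2 * (w : ℝ≥0∞) ^ 2 * (k : ℝ≥0∞) ^ 2 + 2 * (work α : ℝ≥0∞) ^ 2 := by
          refine PMF.expect_mono fun k => PMF.expect_mono fun α => ?_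
          rw [hw]
          refine (hsq _ _).trans (le_of_eq ?_)
          push_cast
          ring
      _ = 2 * (w : ℝ≥0∞) ^ 2 * ((m.p c.1 c.2).expect fun k => (k : ℝ≥0∞) ^ 2)
            + 2 * (arrivalsOf m 1 cs).expect fun α => (work α : ℝ≥0∞) ^ 2 := by
          simp only [PMF.expect_add, PMF.expect_const, PMF.expect_const_mul]
      _ < ∞ := by
          refine ENNReal.add_lt_top.2 ⟨ENNReal.mul_lt_top ?_ hp, ENNReal.mul_lt_top ?_ ih⟩
          · exact_mod_cast ENNReal.natCast_lt_top (2 * w ^ 2)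
          · exact ENNReal.ofNat_lt_top

/-- The real series `EA` would be `0` by default if it diverged; the second moment excludes this, as
`k ≤ k²`. -/
theorem expect_arrivals (l : Fin L) (j : Fin J) :
    ((m.p l j).expect fun k => (k : ℝ≥0∞)) = ENNReal.ofReal (m.EA l j) := by
  have hfin : ((m.p l j).expect fun k => (k : ℝ≥0∞)) ≠ ∞ := by
    refine ne_top_of_le_ne_top (m.secondMoment_finite l j).ne (PMF.expect_mono fun k => ?_)
    exact_mod_cast Nat.le_self_pow two_ne_zero k
  rw [← ENNReal.ofReal_toReal hfin, EA, PMF.expect, ENNReal.tsum_toReal_eq]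
  · simp
  · exact fun k => ENNReal.mul_ne_top ((m.p l j).apply_ne_top k) (ENNReal.natCast_ne_top k)

theorem expect_workload : ((workload m).expect fun k => (k : ℝ≥0∞))
    = ENNReal.ofReal (∑ l, ∑ j, m.EA l j * (⌈m.S l / m.φMin 1 j⌉₊ : ℝ)) := by
  have hEA : ∀ l j, 0 ≤ m.EA l j := fun l j =>
    tsum_nonneg fun k => mul_nonneg ENNReal.toReal_nonneg (Nat.cast_nonneg k)
  have hnn : ∀ l j, 0 ≤ m.EA l j * (⌈m.S l / m.φMin 1 j⌉₊ : ℝ) := fun l j =>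
    mul_nonneg (hEA l j) (Nat.cast_nonneg _)
  have hprod : (List.finRange L ×ˢ List.finRange J)
      = (List.finRange L).flatMap fun l => (List.finRange J).map (Prod.mk l) := rfl
  rw [workload, PMF.expect_map, arrivals, expect_work_arrivalsOf, hprod, List.map_flatMap,
    List.flatMap_def, List.sum_flatten, List.map_map, ← Fin.sum_univ_def,
    ENNReal.ofReal_sum_of_nonneg fun l _ => Finset.sum_nonneg fun j _ => hnn l j]
  refine Finset.sum_congr rfl fun l _ => ?_
  rw [Function.comp_apply, List.map_map, ← Fin.sum_univ_def,
    ENNReal.ofReal_sum_of_nonneg fun j _ => hnn l j]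
  refine Finset.sum_congr rfl fun j _ => ?_
  rw [Function.comp_apply, expect_arrivals, ENNReal.ofReal_mul (hEA l j), ENNReal.ofReal_natCast]

theorem expect_workload_sq : ((workload m).expect fun k => (k : ℝ≥0∞) ^ 2) < ∞ := by
  rw [workload, PMF.expect_map]
  exact expect_work_sq_arrivalsOf _

end MultiAccess

/-! ### Two estimates for laws on `ℕ` with finite second moment -/

/-- Quadratic Lyapunov bound for a random walk with negative drift reflected at zero. -/
theorem PMF.exists_lyapunov {b : PMF ℕ} {ν : ℝ≥0∞} (hb : (b.expect fun k => (k : ℝ≥0∞)) = ν)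
    (hν : ν < 1) (h2 : (b.expect fun k => (k : ℝ≥0∞) ^ 2) < ∞) :
    ∃ f : ℕ → ℝ≥0∞, (∀ v, f v < ∞) ∧ (b.expect f < ∞) ∧
      ∀ v, 1 ≤ v → (b.expect fun k => f (v - 1 + k)) + (1 - ν) * v ≤ f v := by
  set δ := 1 - ν with hδ
  have hδ0 : δ ≠ 0 := (tsub_pos_of_lt hν).ne'
  have hδt : δ ≠ ∞ := ne_top_of_le_ne_top ENNReal.one_ne_top tsub_le_self
  have hνδ : ν + δ = 1 := add_tsub_cancel_of_le hν.le
  -- In `f v = v² + C v` the linear part drifts by `-C δ`, which cancels the second moment produced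
  -- by the square.
  set C := (b.expect fun k => (k : ℝ≥0∞) ^ 2) / δ with hC
  have hCt : C < ∞ := ENNReal.div_lt_top h2.ne hδ0
  have hCδ : C * δ = b.expect fun k => (k : ℝ≥0∞) ^ 2 := ENNReal.div_mul_cancel hδ0 hδt
  have hexp : ∀ u : ℕ, (b.expect fun k => ((u + k : ℕ) : ℝ≥0∞) ^ 2 + C * (u + k : ℕ))
      = u ^ 2 + 2 * u * ν + C * δ + C * u + C * ν := by
    intro u
    have : ∀ k : ℕ, ((u + k : ℕ) : ℝ≥0∞) ^ 2 + C * (u + k : ℕ)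
        = (u ^ 2 + C * u) + ((2 * u + C) * k + k ^ 2) := by
      intro k
      push_cast
      ring
    simp only [this, PMF.expect_add, PMF.expect_const, PMF.expect_const_mul, hb, ← hCδ]
    ring
  refine ⟨fun v => (v : ℝ≥0∞) ^ 2 + C * v, fun v => ?_, ?_, ?_⟩
  · exact ENNReal.add_lt_top.2 ⟨ENNReal.pow_lt_top (ENNReal.natCast_lt_top v),
      ENNReal.mul_lt_top hCt (ENNReal.natCast_lt_top v)⟩
  · have := hexp 0
    simp only [zero_add] at this
    rw [this, hCδ]
    have := ENNReal.mul_lt_top hCt (hν.trans ENNReal.one_lt_top)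
    simp [h2, this]
  · intro v hv
    obtain ⟨u, rfl⟩ := Nat.exists_eq_add_of_le' hv
    rw [Nat.add_sub_cancel, hexp]
    -- With `v = u + 1`, the term `u * δ + ν` is the exact slack; adding it turns the inequality
    -- into an identity without subtraction.
    calc _ ≤ (u : ℝ≥0∞) ^ 2 + 2 * u * ν + C * δ + C * u + C * ν + δ * (u + 1 : ℕ)
          + (u * δ + ν) := le_self_add
      _ = u ^ 2 + 2 * u * (ν + δ) + (ν + δ) + C * u + C * (ν + δ) := by
          push_cast
          ring
      _ = _ := by
          rw [hνδ]
          push_cast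
          ring

/-- A second-order Taylor bound, with the linear term moved to the left so that it passes to `ℝ≥0∞`.
-/
theorem one_sub_pow_add_le {t : ℝ} (h0 : 0 ≤ t) (h1 : t ≤ 1) (k : ℕ) :
    (1 - t) ^ k + t * k ≤ 1 + t ^ 2 * k ^ 2 := by
  induction k with
  | zero => simp
  | succ k ih =>
    have h : (1 - t) ^ k * (1 - t) ≤ (1 + t ^ 2 * k ^ 2 - t * k) * (1 - t) :=
      mul_le_mul_of_nonneg_right (by linarith) (by linarith)
    have h3 : 0 ≤ t ^ 3 * (k : ℝ) ^ 2 := by positivity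
    have h4 : 0 ≤ t ^ 2 * (k : ℝ) := by positivity
    rw [pow_succ]
    push_cast
    nlinarith [sq_nonneg t]

/-- A law on `ℕ` with mean above one and finite variance has a generating function below the
diagonal somewhere in `(0, 1)`. -/
theorem PMF.exists_expect_pow_le {b : PMF ℕ} {e : ℝ} (he : 1 < e)
    (hb : (b.expect fun k => (k : ℝ≥0∞)) = ENNReal.ofReal e)
    (h2 : (b.expect fun k => (k : ℝ≥0∞) ^ 2) < ∞) :
    ∃ θ : ℝ≥0∞, θ < 1 ∧ (b.expect fun k => θ ^ k) ≤ θ := by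
  set M := (b.expect fun k => (k : ℝ≥0∞) ^ 2).toReal with hM
  have hM0 : 0 ≤ M := ENNReal.toReal_nonneg
  have hM2 : (b.expect fun k => (k : ℝ≥0∞) ^ 2) = ENNReal.ofReal M :=
    (ENNReal.ofReal_toReal h2.ne).symm
  -- The Taylor bound gives `𝔼 (1 - t) ^ B ≤ 1 - t e + t² M`, which is at most `1 - t` once `t M ≤ e
  -- - 1`. The `M + 1` keeps the denominator positive.
  set t := min 1 ((e - 1) / (M + 1)) with ht
  have ht0 : 0 < t := lt_min one_pos (div_pos (by linarith) (by linarith))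
  have ht1 : t ≤ 1 := min_le_left _ _
  have htM : t * M ≤ e - 1 := by
    have : t * (M + 1) ≤ e - 1 := (le_div_iff₀ (by linarith)).1 (min_le_right _ _)
    linarith
  refine ⟨ENNReal.ofReal (1 - t), by rw [ENNReal.ofReal_lt_one]; linarith, ?_⟩
  have key : (b.expect fun k => ENNReal.ofReal (1 - t) ^ k) + ENNReal.ofReal t * ENNReal.ofReal e
      ≤ 1 + ENNReal.ofReal (t ^ 2) * ENNReal.ofReal M := by
    rw [← hb, ← hM2, ← PMF.expect_const_mul, ← PMF.expect_const_mul, ← PMF.expect_add,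
      ← PMF.expect_const b 1, ← PMF.expect_add]
    refine PMF.expect_mono fun k => ?_
    have hk := ENNReal.ofReal_le_ofReal (one_sub_pow_add_le ht0.le ht1 k)
    rw [ENNReal.ofReal_add (by have := sub_nonneg.2 ht1; positivity) (by positivity),
      ENNReal.ofReal_add zero_le_one (by positivity), ENNReal.ofReal_mul ht0.le,
      ENNReal.ofReal_mul (sq_nonneg t), ENNReal.ofReal_pow (sub_nonneg.2 ht1),
      ENNReal.ofReal_pow (Nat.cast_nonneg k), ENNReal.ofReal_natCast, ENNReal.ofReal_one] at hk
    exact hk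
  rw [← ENNReal.ofReal_mul ht0.le, ← ENNReal.ofReal_mul (sq_nonneg t), ← ENNReal.ofReal_one,
    ← ENNReal.ofReal_add zero_le_one (by positivity)] at key
  have key2 : (b.expect fun k => ENNReal.ofReal (1 - t) ^ k) + ENNReal.ofReal (t * e)
      ≤ ENNReal.ofReal (1 - t) + ENNReal.ofReal (t * e) := by
    refine key.trans ?_
    rw [← ENNReal.ofReal_add (sub_nonneg.2 ht1) (by positivity)]
    exact ENNReal.ofReal_le_ofReal (by nlinarith)
  exact (ENNReal.add_le_add_iff_right ENNReal.ofReal_ne_top).1 key2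

/-! ### Transience and positive recurrence of the system -/

namespace MultiAccess

open DiscreteChain

variable {L J : ℕ} {m : MultiAccess L J} (ω : NonIdlingPolicy m 1) (r : SelectionRule m 1)

theorem isTransient_of_one_lt_load
    (h : 1 < ∑ l, ∑ j, m.EA l j * (⌈m.S l / m.φMin 1 j⌉₊ : ℝ)) :
    IsTransient (transition ω r) := by
  obtain ⟨θ, hθ1, hθ⟩ := PMF.exists_expect_pow_le h expect_workload expect_workload_sq
  -- A batch of work at least two carries the chain strictly above the level `work x` in one step,
  -- making the return bound strict.
  obtain ⟨k, hk, hk2⟩ : ∃ k ∈ (workload m).support, 2 ≤ k := by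
    by_contra! hcon
    have : ((workload m).expect fun k => (k : ℝ≥0∞)) ≤ 1 := by
      rw [← PMF.expect_const (workload m) 1]
      refine PMF.expect_mono_of_support fun k hk => ?_
      exact_mod_cast Nat.le_of_lt_succ (hcon k hk)
    rw [expect_workload, ENNReal.ofReal_le_one] at this
    linarith
  intro x
  refine (returnProb_le_expect (transition ω r) x (f := fun z => θ ^ (work z - work x))
    (by simp) (fun z => ?_) x).trans_lt ?_
  · rw [expect_transition ω r (fun v => θ ^ (v - work x))]
    rcases le_or_gt (work z) (work x) with hz | hz
    · rw [Nat.sub_eq_zero_of_le hz, pow_zero, ← PMF.expect_const (workload m) 1]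
      exact PMF.expect_mono fun i => pow_le_one₀ zero_le hθ1.le
    -- Strictly above the level no truncation occurs, so a slot multiplies the function by `θ ^ (i -
    -- 1)`, of mean at most one by `hθ`.
    · have e : ∀ i, θ ^ (work z - 1 + i - work x) = θ ^ (work z - work x - 1) * θ ^ i := by
        intro i
        rw [← pow_add]
        congr 1
        omega
      simp only [e, PMF.expect_const_mul]
      calc _ ≤ θ ^ (work z - work x - 1) * θ := by gcongr
        _ = _ := by rw [← pow_succ]; congr 1; omega
  · rw [expect_transition ω r (fun v => θ ^ (v - work x))]
    exact PMF.expect_lt_one (fun i => pow_le_one₀ zero_le hθ1.le) hk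
      (pow_lt_one₀ zero_le hθ1 (by omega))

theorem meanReturnTime_and_work_of_load_lt_one
    (h : ∑ l, ∑ j, m.EA l j * (⌈m.S l / m.φMin 1 j⌉₊ : ℝ) < 1) :
    (∀ x, meanReturnTime (transition ω r) x [] < ∞) ∧
      ∑' n, (taboo (transition ω r) [])^[n] (fun α => (work α : ℝ≥0∞)) [] < ∞ := by
  obtain ⟨f, hf, hbf, hdrift⟩ := PMF.exists_lyapunov expect_workload
    (ENNReal.ofReal_lt_one.2 h) expect_workload_sq
  set δ := 1 - ENNReal.ofReal (∑ l, ∑ j, m.EA l j * (⌈m.S l / m.φMin 1 j⌉₊ : ℝ))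
  have hδ0 : δ ≠ 0 := (tsub_pos_of_lt (ENNReal.ofReal_lt_one.2 h)).ne'
  have hδt : δ ≠ ∞ := ne_top_of_le_ne_top ENNReal.one_ne_top tsub_le_self
  have h0 : ((transition ω r []).expect fun β => f (work β)) < ∞ := by
    rw [expect_transition]
    simpa [work] using hbf
  -- Scaled by `δ⁻¹`, the Lyapunov function pays for the reward `work`; as the work is at least one
  -- off the empty state, it also pays for the reward `1`.
  have hw : ∀ x : State m 1, x ≠ [] → ((transition ω r x).expect fun z => δ⁻¹ * f (work z))
      + work x ≤ δ⁻¹ * f (work x) := by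
    intro x hx
    rw [PMF.expect_const_mul, expect_transition]
    have := mul_le_mul_right (hdrift (work x) (work_pos hx)) δ⁻¹
    rwa [mul_add, ← mul_assoc, ENNReal.inv_mul_cancel hδ0 hδt, one_mul] at this
  have h1 : ∀ x : State m 1, x ≠ [] → ((transition ω r x).expect fun z => δ⁻¹ * f (work z))
      + 1 ≤ δ⁻¹ * f (work x) := fun x hx =>
    le_trans (by gcongr; exact_mod_cast work_pos hx) (hw x hx)
  have hself : ((transition ω r []).expect fun z => δ⁻¹ * f (work z)) < ∞ := by
    rw [PMF.expect_const_mul]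
    exact ENNReal.mul_lt_top (ENNReal.inv_lt_top.2 hδ0.bot_lt) h0
  refine ⟨fun x => ?_, ?_⟩
  · simp only [meanReturnTime, avoidUpTo_eq_iterate]
    rcases eq_or_ne x [] with rfl | hx
    · exact (tsum_iterate_taboo_self_le _ _ h1).trans_lt
        (ENNReal.add_lt_top.2 ⟨ENNReal.one_lt_top, hself⟩)
    · exact (tsum_iterate_taboo_le _ _ h1 hx).trans_lt
        (ENNReal.mul_lt_top (ENNReal.inv_lt_top.2 hδ0.bot_lt) (hf _))
  · exact (tsum_iterate_taboo_self_le _ _ hw).trans_lt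
      (ENNReal.add_lt_top.2 ⟨by simp [work], hself⟩)

end MultiAccess

theorem mainTheorem2 {L J : ℕ} (m : MultiAccess L J)
    (ω : MultiAccess.NonIdlingPolicy m 1) (r : MultiAccess.SelectionRule m 1) :
    (∑ l, ∑ j, m.EA l j * (⌈m.S l / m.φMin 1 j⌉₊ : ℝ) < 1 →
      DiscreteChain.IsPositiveRecurrent (MultiAccess.transition ω r) ∧
      ∃ π : PMF (MultiAccess.State m 1),
        DiscreteChain.IsStationary (MultiAccess.transition ω r) π ∧
        (∀ π', DiscreteChain.IsStationary (MultiAccess.transition ω r) π' → π' = π) ∧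
        ∀ l j, ∑' α, π α * (MultiAccess.count α l j : ℝ≥0∞) < ∞) ∧
    (1 < ∑ l, ∑ j, m.EA l j * (⌈m.S l / m.φMin 1 j⌉₊ : ℝ) →
      DiscreteChain.IsTransient (MultiAccess.transition ω r)) := by
  refine ⟨fun h => ?_, MultiAccess.isTransient_of_one_lt_load ω r⟩
  obtain ⟨hτ, hwork⟩ := MultiAccess.meanReturnTime_and_work_of_load_lt_one ω r h
  refine ⟨⟨[], hτ⟩, DiscreteChain.excursionLaw _ [] (hτ []),
    DiscreteChain.isStationary_excursionLaw _ [] (hτ []),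
    fun π' hπ' => hπ'.eq_excursionLaw _ [] hτ, fun l j => ?_⟩
  simp only [DiscreteChain.excursionLaw_apply]
  -- The stationary mean of the work is the mean work summed over an excursion divided by the mean
  -- return time.
  calc _ ≤ ∑' α, (DiscreteChain.meanReturnTime (MultiAccess.transition ω r) [] [])⁻¹ *
        (DiscreteChain.occupation (MultiAccess.transition ω r) [] α * MultiAccess.work α) := by
        refine ENNReal.tsum_le_tsum fun α => ?_
        rw [mul_comm (DiscreteChain.occupation _ _ _), mul_assoc]
        gcongr
        exact MultiAccess.count_le_work α l j
    _ < ∞ := by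
        rw [ENNReal.tsum_mul_left, DiscreteChain.tsum_occupation_mul]
        refine ENNReal.mul_lt_top (ENNReal.inv_lt_top.2 ?_) hwork
        exact zero_lt_one.trans_le (DiscreteChain.one_le_meanReturnTime _ _ _)
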